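/- Let $N\ge 2$, let $A=(A_{ij})_{0\le i,j\le N-1}$ be a nonzero matrix with entries in $\{0,1\}$, and let $D=\#\{(i,j): A_{ij}=1\}$. Let $\mathbb S_A\subset[0,1]^2$ be the set of points $(x,y)$ that admit $N$-adic expansions $x=\sum_{k\ge1}x_kN^{-k}$, $y=\sum_{k\ge1}y_kN^{-k}$ with digits $x_k,y_k\in\{0,\dots,N-1\}$ and $A_{x_ky_k}=1$ for all $k\ge 1$, with the Euclidean metric. For $(i,j)$ with $A_{ij}=1$ let $\tau_{(i,j)}:\mathbb S_A\to\mathbb S_A$ be the everywhere-defined map $\tau_{(i,j)}(x,y)=\left(\frac{x+i}{N},\frac{y+j}{N}\right)$, with range $R_{(i,j)}$. Then the Hausdorff dimension of $\mathbb S_A$ is $s=\frac{\log D}{\log N}$, and the $s$-dimensional Hausdorff measure $\mu$ on $\mathbb S_A$ satisfies $0<\mu(\mathbb S_A)<\infty$. The maps $\tau_{(i,j)}$, $A_{ij}=1$, form a semibranching function system on $(\mathbb S_A,\mu)$: they are measurable, their ranges are measurable, cover $\mathbb S_A$ up to a $\mu$-null set and intersect pairwise in $\mu$-null sets, and for each $(i,j)$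 there is a Radon–Nikodym derivative $\Phi_{(i,j)}=\frac{d(\mu\circ\tau_{(i,j)})}{d\mu}$, where $(\mu\circ\tau_{(i,j)})(E)=\mu(\tau_{(i,j)}(E))$, which is positive $\mu$-almost everywhere. The system has a coding map, that is, a measurable map $\tau:\mathbb S_A\to\mathbb S_A$ with $\tau\circ\tau_{(i,j)}=\mathrm{id}$ $\mu$-almost everywhere for all $(i,j)$ with $A_{ij}=1$. For every such $\tau$ (and every choice of the $\Phi_{(i,j)}$) the formula $$S_{(i,j)}f=\chi_{R_{(i,j)}}\cdot(\Phi_{(i,j)}\circ\tau)^{-1/2}\cdot (f\circ\tau)$$ defines bounded operators on $L^2(\mathbb S_A,\mu)$ with $$S_{(i,j)}^*S_{(i,j)}=1\ \text{ for all } (i,j) \text{ with } A_{ij}=1,\qquad \sum_{(i,j):A_{ij}=1}S_{(i,j)}S_{(i,j)}^*=1,$$ so that they determine a representation of the Cuntz algebra $O_D$: writing $O_D$ for the universal unital $C^*$-algebra generated by elements $s_{(i,j)}$, $A_{ij}=1$, subject to these relations, there is a unique unital $*$-homomorphism $\pi:O_D\to B(L^2(\mathbb S_A,\mu))$ with $\pi(s_{(i,j)})=S_{(i,j)}$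 for all $(i,j)$ with $A_{ij}=1$. -/

import Mathlib

open MeasureTheory Set
open scoped ENNReal NNReal

/-! ### Semibranching function systems -/

section Semibranching

variable {X ι : Type*} [MeasurableSpace X]

/-- `Φ` is the Radon-Nikodym derivative `d(μ ∘ σ)/dμ` on the domain `D` of the map `σ`,
where `(μ ∘ σ)(E) = μ (σ(E))` for measurable `E ⊆ D`. -/
def IsRadonNikodymAlong (μ : Measure X) (D : Set X) (σ : X → X) (Φ : X → ℝ≥0) : Prop :=
  Measurable Φ ∧
    ∀ E : Set X, E ⊆ D → MeasurableSet E → μ (σ '' E) = ∫⁻ x in E, (Φ x : ℝ≥0∞) ∂μ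

/-- The family of maps `σ i`, with domains `D i ⊆ X`, is a semibranching function system
on `(X, μ)`. The values of `σ i` outside `D i` play no role. -/
structure IsSemibranchingSystem (μ : Measure X) (D : ι → Set X) (σ : ι → X → X) : Prop where
  measurableSet_domain : ∀ i, MeasurableSet (D i)
  measurable_map : ∀ i, Measurable ((D i).domRestrict (σ i))
  measurableSet_range : ∀ i, MeasurableSet (σ i '' D i)
  cover : μ (⋃ i, σ i '' D i)ᶜ = 0
  overlap : ∀ i j, i ≠ j → μ ((σ i '' D i) ∩ (σ j '' D j)) = 0
  radonNikodym : ∀ i, ∃ Φ : X → ℝ≥0,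
    IsRadonNikodymAlong μ (D i) (σ i) Φ ∧ ∀ᵐ x ∂μ, x ∈ D i → 0 < Φ x

/-- `c` is a coding map for the family `σ i : D i → X`: a measurable common left inverse
(up to null sets, as the ranges are only almost disjoint). -/
def IsCodingMap (μ : Measure X) (D : ι → Set X) (σ : ι → X → X) (c : X → X) : Prop :=
  Measurable c ∧ ∀ i, ∀ᵐ x ∂μ, x ∈ D i → c (σ i x) = x

/-- `T` is the operator `(T ψ)(x) = χ_R(x) (Φ(c(x)))^(-1/2) ψ(c(x))` on `L²(X, μ)`, where `R` is
the range of one map of the system, `Φ` its Radon-Nikodym derivative, and `c` a coding map. -/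
def IsBranchOperator (μ : Measure X) (R : Set X) (Φ : X → ℝ≥0) (c : X → X)
    (T : Lp ℂ 2 μ →L[ℂ] Lp ℂ 2 μ) : Prop :=
  ∀ ψ : Lp ℂ 2 μ,
    (T ψ : X → ℂ) =ᵐ[μ] R.indicator fun x => (((Φ (c x) : ℝ) ^ (-(1 / 2) : ℝ) : ℝ) : ℂ) * ψ (c x)

end Semibranching

/-! ### The Cuntz algebra -/

section Cuntz

/-- The Cuntz relations `Sᵢ* Sᵢ = 1`, `∑ᵢ Sᵢ Sᵢ* = 1`. -/
def CuntzRelations {ι B : Type*} [Fintype ι] [Semiring B] [Star B] (S : ι → B) : Prop :=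
  (∀ i, star (S i) * S i = 1) ∧ ∑ i, S i * star (S i) = 1

/-- A family satisfying the Cuntz relations in a nonzero unital C⋆-algebra. -/
structure CuntzFamily (ι : Type*) [Fintype ι] where
  carrier : Type
  [cstar : CStarAlgebra carrier]
  [nontriv : Nontrivial carrier]
  gen : ι → carrier
  rel : CuntzRelations gen

attribute [instance] CuntzFamily.cstar CuntzFamily.nontriv

variable (ι : Type*) [Fintype ι]

theorem CuntzFamily.norm_gen_le {ι : Type*} [Fintype ι] (F : CuntzFamily ι) (i : ι) :
    ‖F.gen i‖ ≤ 1 := by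
  have h : ‖F.gen i‖ * ‖F.gen i‖ = 1 := by
    rw [← CStarRing.norm_star_mul_self, F.rel.1 i, norm_one]
  nlinarith [norm_nonneg (F.gen i)]

/-- The generators of the universal Cuntz family: `i ↦ (Sᵢ)` in the bounded product over all
Cuntz families. -/
noncomputable def cuntzGenAux (i : ι) : lp (fun F : CuntzFamily ι => F.carrier) ∞ :=
  ⟨fun F => F.gen i, memℓp_infty ⟨1, by rintro _ ⟨F, rfl⟩; exact F.norm_gen_le i⟩⟩

/-- The Cuntz algebra `O_n`, `n = #ι`: the universal C⋆-algebra generated by elements `Sᵢ`, `i : ι`,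
subject to the Cuntz relations. It is realized as the closed ⋆-subalgebra generated by the
universal family in the bounded product over all Cuntz families, that is, it carries the largest
C⋆-norm coming from Cuntz families. -/
noncomputable def cuntzAlgebra :
    StarSubalgebra ℂ (lp (fun F : CuntzFamily ι => F.carrier) ∞) :=
  (StarAlgebra.adjoin ℂ (Set.range (cuntzGenAux ι))).topologicalClosure

/-- The standard generators of the Cuntz algebra. -/
noncomputable def cuntzGen (i : ι) : cuntzAlgebra ι :=
  ⟨cuntzGenAux ι i, StarSubalgebra.le_topologicalClosure _
    (StarAlgebra.subset_adjoin ℂ _ (Set.mem_range_self i))⟩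

end Cuntz

/-! ### The Sierpinski fractal of a `0-1` matrix -/

section Sierpinski

variable {N : ℕ}

/-- The number `0.a₁a₂a₃…` in base `N` (digits are indexed from `0` here). -/
noncomputable def nAdic (a : ℕ → Fin N) : ℝ := ∑' k, (a k : ℝ) / (N : ℝ) ^ (k + 1)

/-- The set of points `(x, y)` of the plane with `N`-adic expansions `x = 0.x₁x₂…`, `y = 0.y₁y₂…`
such that `A_{xᵢ yᵢ} = 1` for all `i`. -/
def sierpinski (A : Matrix (Fin N) (Fin N) ℕ) : Set (EuclideanSpace ℝ (Fin 2)) :=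
  {z | ∃ a b : ℕ → Fin N, (∀ k, A (a k) (b k) = 1) ∧ z = !₂[nAdic a, nAdic b]}

/-- The pairs `(i, j)` with `A_{ij} = 1`. -/
abbrev OneEntry (A : Matrix (Fin N) (Fin N) ℕ) : Type :=
  {p : Fin N × Fin N // A p.1 p.2 = 1}

/-- `D = ∑ᵢ dᵢ`, with `dᵢ` the number of `j` with `A_{ij} = 1`. -/
def numOnes (A : Matrix (Fin N) (Fin N) ℕ) : ℕ :=
  ∑ i, (Finset.univ.filter fun j => A i j = 1).card

theorem card_oneEntry (A : Matrix (Fin N) (Fin N) ℕ) :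
    Fintype.card (OneEntry A) = numOnes A := by
  simp only [Fintype.card_subtype, numOnes, Finset.card_filter, Fintype.sum_prod_type]

theorem nAdic_summable (a : ℕ → Fin N) :
    Summable fun k => (a k : ℝ) / (N : ℝ) ^ (k + 1) := by
  have hN : 0 < N := (a 0).pos
  rcases Nat.lt_or_ge N 2 with h | h
  · obtain rfl : N = 1 := by omega
    have : ∀ k, ((a k : ℕ) : ℝ) = 0 := fun k => by simp [Subsingleton.elim (a k) 0]
    simp only [this, zero_div]
    exact summable_zero
  · have hN' : (0 : ℝ) < N := by exact_mod_cast hN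
    have h1 : (N : ℝ)⁻¹ < 1 := inv_lt_one_of_one_lt₀ (by exact_mod_cast h)
    refine Summable.of_nonneg_of_le (fun k => by positivity) (fun k => ?_)
      (summable_geometric_of_lt_one (by positivity) h1)
    have h2 : ((a k : ℕ) : ℝ) ≤ N := by exact_mod_cast (a k).isLt.le
    rw [inv_pow, pow_succ, div_le_iff₀ (by positivity)]
    field_simp
    exact h2

/-- Prepending the digit `i` is the map `x ↦ (x + i) / N`. -/
theorem nAdic_cons (i : Fin N) (a : ℕ → Fin N) :
    nAdic (fun k => Nat.casesOn k i a : ℕ → Fin N) = (nAdic a + (i : ℝ)) / N := by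
  have hN' : (N : ℝ) ≠ 0 := by exact_mod_cast i.pos.ne'
  unfold nAdic
  rw [(nAdic_summable _).tsum_eq_zero_add, add_div, add_comm, ← tsum_div_const]
  congr 1
  · refine tsum_congr fun k => ?_
    show (a k : ℝ) / (N : ℝ) ^ (k + 1 + 1) = _
    rw [pow_succ _ (k + 1), div_div]
  · show (i : ℝ) / (N : ℝ) ^ (0 + 1) = _
    simp

/-- The everywhere defined map `τ_{(i,j)}(x, y) = ((x + i)/N, (y + j)/N)` on the fractal,
for `A_{ij} = 1`. -/
noncomputable def tau (A : Matrix (Fin N) (Fin N) ℕ) (p : OneEntry A) (z : sierpinski A) :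
    sierpinski A :=
  ⟨!₂[(z.1 0 + (p.1.1 : ℝ)) / N, (z.1 1 + (p.1.2 : ℝ)) / N], by
    obtain ⟨z, a, b, hab, rfl⟩ := z
    refine ⟨fun k => Nat.casesOn k p.1.1 a, fun k => Nat.casesOn k p.1.2 b, ?_, ?_⟩
    · rintro (_ | k)
      · exact p.2
      · exact hab k
    · rw [nAdic_cons, nAdic_cons]
      simp⟩

/-- The `s`-dimensional Hausdorff measure of the Euclidean metric on the fractal. -/
noncomputable def sierpinskiMeasure (A : Matrix (Fin N) (Fin N) ℕ) (s : ℝ) :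
    Measure (sierpinski A) :=
  Measure.hausdorffMeasure s

end Sierpinski

/-! Each τ_p is a similarity of ratio N⁻¹, so it scales the s-dimensional Hausdorff measure μ by
N⁻ˢ, and s is chosen so that D · N⁻ˢ = 1. Finiteness of μ: the D ^ n pieces of level n have
diameters at most N⁻ⁿ δ, with δ the diameter of the fractal, so their s-th powers sum to at most δ ^
s (`hausdorffMeasure_sierpinski_lt_top`). Positivity is the mass distribution principle for the
pushforward of the uniform Bernoulli measure on digit sequences (`hausdorffMeasure_sierpinski_pos`).
Together they give the dimension. The D first-level pieces cover the fractal and their masses add up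
to μ(𝕊_A) < ∞, so overlaps are null (`isScalingSystem_tau`).

The operator theory needs only such a scaling system. Its Radon-Nikodym derivatives are a.e.
constant; each S_p is an isometry because r ^ (-1/2) compensates the scaling by r; almost disjoint
ranges make the images orthogonal, and the null complement of their union makes the images span L²
(`cuntzRelations_branchIsometry`). The representation is evaluation at one coordinate of the product
defining O_D. -/

/-! ### The universal property of the Cuntz algebra -/

section CuntzUniversal

variable {ι : Type*} [Fintype ι]

/-- Evaluation of an element of the bounded product at one Cuntz family. -/
def cuntzEval (F : CuntzFamily ι) : lp (fun F : CuntzFamily ι => F.carrier) ∞ →⋆ₐ[ℂ] F.carrier where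
  toFun f := f F
  map_one' := rfl
  map_mul' _ _ := rfl
  map_zero' := rfl
  map_add' _ _ := rfl
  commutes' _ := rfl
  map_star' _ := rfl

/-- A ⋆-homomorphism between C⋆-algebras is contractive; closedness of the subalgebra supplies
completeness of the domain. -/
theorem StarAlgHom.continuous_cuntzAlgebra {B : Type*} [CStarAlgebra B]
    (φ : cuntzAlgebra ι →⋆ₐ[ℂ] B) : Continuous φ := by
  let _ : CStarAlgebra (lp (fun F : CuntzFamily ι => F.carrier) ∞) := { }
  let _ : CStarAlgebra (cuntzAlgebra ι) :=
    StarSubalgebra.cstarAlgebra (cuntzAlgebra ι)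
      (h_closed := StarSubalgebra.isClosed_topologicalClosure _)
  exact AddMonoidHomClass.continuous_of_bound φ 1 fun a => by
    simpa only [one_mul] using NonUnitalStarAlgHom.norm_apply_le φ a

/-- A ⋆-homomorphism on the Cuntz algebra is determined by its values on the generators. -/
theorem cuntzAlgebra_hom_ext {B : Type*} [CStarAlgebra B] {φ ψ : cuntzAlgebra ι →⋆ₐ[ℂ] B}
    (h : ∀ i, φ (cuntzGen ι i) = ψ (cuntzGen ι i)) : φ = ψ := by
  refine StarAlgHom.ext_topologicalClosure φ.continuous_cuntzAlgebra ψ.continuous_cuntzAlgebra ?_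
  refine StarAlgHom.ext_adjoin ?_
  rintro ⟨_, _⟩ ⟨i, rfl⟩
  exact h i

/-- The universal property of the Cuntz algebra. -/
theorem existsUnique_cuntzAlgebra_hom {B : Type} [CStarAlgebra B] [Nontrivial B] {S : ι → B}
    (hS : CuntzRelations S) :
    ∃! π : cuntzAlgebra ι →⋆ₐ[ℂ] B, ∀ i, π (cuntzGen ι i) = S i :=
  -- `(B, S)` is itself an index of the product, which is why `B` lives in `Type` and must be
  -- nontrivial.
  ⟨(cuntzEval ⟨B, S, hS⟩).comp (cuntzAlgebra ι).subtype, fun _ => rfl,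
    fun _ h => cuntzAlgebra_hom_ext fun i => h i⟩

end CuntzUniversal

/-! ### Semibranching function systems that scale the measure -/

section ScalingSystem

variable {X ι : Type*} [MeasurableSpace X]

/-- The injections `σ i : X → X` scale the measure `μ` by the constants `r i ≠ 0`, and their ranges
form a partition of `X` up to null sets. -/
structure IsScalingSystem (μ : Measure X) (σ : ι → X → X) (r : ι → ℝ≥0) : Prop where
  measurableEmbedding : ∀ i, MeasurableEmbedding (σ i)
  ratio_ne_zero : ∀ i, r i ≠ 0
  measure_image : ∀ i E, MeasurableSet E → μ (σ i '' E) = r i * μ E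
  cover : μ (⋃ i, range (σ i))ᶜ = 0
  overlap : ∀ i j, i ≠ j → μ (range (σ i) ∩ range (σ j)) = 0

namespace IsScalingSystem

variable {μ : Measure X} {σ : ι → X → X} {r : ι → ℝ≥0} (h : IsScalingSystem μ σ r)
include h

theorem restrict_range (i : ι) : μ.restrict (range (σ i)) = r i • μ.map (σ i) := by
  ext E hE
  have hi := h.measurableEmbedding i
  rw [Measure.restrict_apply hE, Measure.smul_apply, Measure.map_apply hi.measurable hE,
    ← image_preimage_eq_inter_range, h.measure_image i _ (hi.measurable hE)]
  rfl

theorem quasiMeasurePreserving (i : ι) : Measure.QuasiMeasurePreserving (σ i) μ μ := by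
  refine ⟨(h.measurableEmbedding i).measurable, ?_⟩
  refine (Measure.absolutelyContinuous_smul (c := r i) (by simpa using h.ratio_ne_zero i)).trans ?_
  rw [← ENNReal.smul_def, ← h.restrict_range i]
  exact Measure.absolutelyContinuous_of_le Measure.restrict_le_self

/-- On each range, μ is a multiple of the pushforward by `σ i`, and countably many ranges cover
almost everything. Almost everywhere claims can thus be checked branch by branch. -/
theorem ae_of_forall_ae_comp [Countable ι] {p : X → Prop} (hp : ∀ i, ∀ᵐ x ∂μ, p (σ i x)) :
    ∀ᵐ x ∂μ, p x := by
  have h1 : ∀ i, ∀ᵐ x ∂μ, x ∈ range (σ i) → p x := fun i => by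
    rw [← ae_restrict_iff' (h.measurableEmbedding i).measurableSet_range, h.restrict_range i]
    exact Measure.ae_smul_measure ((h.measurableEmbedding i).ae_map_iff.2 (hp i)) _
  have h2 : ∀ᵐ x ∂μ, x ∈ ⋃ i, range (σ i) := h.cover
  filter_upwards [ae_all_iff.2 h1, h2] with x hx hx'
  obtain ⟨i, hi⟩ := mem_iUnion.1 hx'
  exact hx i hi

theorem ae_notMem_range {i j : ι} (hij : i ≠ j) : ∀ᵐ x ∂μ, σ j x ∉ range (σ i) := by
  have h1 : ∀ᵐ x ∂μ, x ∉ range (σ i) ∩ range (σ j) :=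
    measure_eq_zero_iff_ae_notMem.1 (h.overlap i j hij)
  filter_upwards [(h.quasiMeasurePreserving j).ae h1] with x hx hx'
  exact hx ⟨hx', mem_range_self x⟩

theorem isSemibranchingSystem : IsSemibranchingSystem μ (fun _ => univ) σ where
  measurableSet_domain _ := .univ
  measurable_map i := (h.measurableEmbedding i).measurable.comp measurable_subtype_coe
  measurableSet_range i := (h.measurableEmbedding i).measurableSet_image.2 .univ
  cover := by simpa only [image_univ] using h.cover
  overlap i j hij := by simpa only [image_univ] using h.overlap i j hij
  radonNikodym i := ⟨fun _ => r i, ⟨measurable_const, fun E _ hE => by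
    rw [h.measure_image i E hE, setLIntegral_const]⟩,
    .of_forall fun _ _ => pos_iff_ne_zero.2 (h.ratio_ne_zero i)⟩

/-- The Radon-Nikodym derivatives of a system that scales the measure are constant. -/
theorem radonNikodym_ae_eq [SigmaFinite μ] {i : ι} {Φ : X → ℝ≥0}
    (hΦ : IsRadonNikodymAlong μ univ (σ i) Φ) : ∀ᵐ x ∂μ, Φ x = r i := by
  have h1 : (fun x => (Φ x : ℝ≥0∞)) =ᵐ[μ] fun _ => (r i : ℝ≥0∞) := by
    refine ae_eq_of_forall_setLIntegral_eq_of_sigmaFinite hΦ.1.coe_nnreal_ennreal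
      measurable_const fun E hE _ => ?_
    rw [← hΦ.2 E (subset_univ E) hE, h.measure_image i E hE, setLIntegral_const]
  filter_upwards [h1] with x hx
  exact ENNReal.coe_inj.1 hx

theorem exists_isCodingMap [Countable ι] [Nonempty ι] :
    ∃ c, IsCodingMap μ (fun _ : ι => univ) σ c := by
  rcases isEmpty_or_nonempty X with hX | hX
  · exact ⟨id, measurable_id, fun i => .of_forall fun x => hX.elim x⟩
  have hmeas i := (h.measurableEmbedding i).measurableSet_range
  obtain ⟨c, hc, hc'⟩ := exists_measurable_piecewise
    -- Removing the other ranges, a null change, makes the pieces disjoint, so the inverse branches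
    -- glue with no compatibility condition.
    (fun i => range (σ i) \ ⋃ j, ⋃ (_ : j ≠ i), range (σ j))
    (fun i => (hmeas i).diff (.iUnion fun j => .iUnion fun _ => hmeas j))
    (fun i => (h.measurableEmbedding i).invFun)
    (fun i => (h.measurableEmbedding i).measurable_invFun)
    (fun i j hij x hx => (hx.1.2 (mem_iUnion₂.2 ⟨j, hij.symm, hx.2.1⟩)).elim)
  refine ⟨c, hc, fun i => ?_⟩
  have h1 : ∀ᵐ x ∂μ, ∀ j, j ≠ i → σ i x ∉ range (σ j) :=
    ae_all_iff.2 fun j => by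
      by_cases hji : j = i
      · exact .of_forall fun x hx => (hx hji).elim
      · filter_upwards [h.ae_notMem_range hji] with x hx _ using hx
  filter_upwards [h1] with x hx _
  rw [hc' i ⟨mem_range_self x, by simpa only [mem_iUnion₂, not_exists] using hx⟩]
  exact (h.measurableEmbedding i).leftInverse_invFun x

end IsScalingSystem

/-- The function `x ↦ χ_{σ i (X)}(x) (r i)^(-1/2) f(c(x))`. -/
noncomputable def branchFun (σ : ι → X → X) (r : ι → ℝ≥0) (c : X → X) (i : ι) (f : X → ℂ) :
    X → ℂ :=
  (range (σ i)).indicator fun x => (((r i : ℝ) ^ (-(1 / 2) : ℝ) : ℝ) : ℂ) * f (c x)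

variable {μ : Measure X} {σ : ι → X → X} {r : ι → ℝ≥0} {c : X → X}

omit [MeasurableSpace X] in
theorem branchFun_add (i : ι) (f g : X → ℂ) :
    branchFun σ r c i (f + g) = branchFun σ r c i f + branchFun σ r c i g := by
  ext x
  by_cases hx : x ∈ range (σ i) <;> simp [branchFun, hx, mul_add]

omit [MeasurableSpace X] in
theorem branchFun_smul (i : ι) (a : ℂ) (f : X → ℂ) :
    branchFun σ r c i (a • f) = a • branchFun σ r c i f := by
  ext x
  by_cases hx : x ∈ range (σ i) <;> simp [branchFun, hx, mul_left_comm]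

theorem branchFun_comp_self (hc : IsCodingMap μ (fun _ : ι => univ) σ c) (i : ι) (f : X → ℂ) :
    ∀ᵐ x ∂μ, branchFun σ r c i f (σ i x) = (((r i : ℝ) ^ (-(1 / 2) : ℝ) : ℝ) : ℂ) * f x := by
  filter_upwards [hc.2 i] with x hx
  rw [branchFun, indicator_of_mem (mem_range_self x), hx (mem_univ x)]

namespace IsScalingSystem

theorem branchFun_comp_of_ne (h : IsScalingSystem μ σ r) {i j : ι} (hij : i ≠ j) (f : X → ℂ) :
    ∀ᵐ x ∂μ, branchFun σ r c i f (σ j x) = 0 := by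
  filter_upwards [h.ae_notMem_range hij] with x hx
  rw [branchFun, indicator_of_notMem hx]

variable [Countable ι] (h : IsScalingSystem μ σ r) (hc : IsCodingMap μ (fun _ : ι => univ) σ c)
include h hc

/-- On each branch `c ∘ σ i` is a.e. the identity, so preimages of null sets are null. This makes `f
∘ c` well defined on a.e. classes. -/
theorem quasiMeasurePreserving_codingMap : Measure.QuasiMeasurePreserving c μ μ := by
  refine ⟨hc.1, .mk fun Z hZ hZ0 => ?_⟩
  rw [Measure.map_apply hc.1 hZ]
  refine measure_eq_zero_iff_ae_notMem.2 (h.ae_of_forall_ae_comp fun i => ?_)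
  filter_upwards [hc.2 i, measure_eq_zero_iff_ae_notMem.1 hZ0] with x hx hx'
  rwa [mem_preimage, hx (mem_univ x)]

theorem branchFun_ae_congr (i : ι) {f g : X → ℂ} (hfg : f =ᵐ[μ] g) :
    branchFun σ r c i f =ᵐ[μ] branchFun σ r c i g := by
  filter_upwards [(h.quasiMeasurePreserving_codingMap hc).ae hfg] with x hx
  simp only [branchFun, indicator, hx]

theorem aestronglyMeasurable_branchFun (i : ι) {f : X → ℂ} (hf : AEStronglyMeasurable f μ) :
    AEStronglyMeasurable (branchFun σ r c i f) μ :=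
  ((hf.comp_quasiMeasurePreserving (h.quasiMeasurePreserving_codingMap hc)).const_mul _).indicator
    (h.measurableEmbedding i).measurableSet_range

omit [Countable ι] in
theorem eLpNorm_branchFun (i : ι) (f : X → ℂ) :
    eLpNorm (branchFun σ r c i f) 2 μ = eLpNorm f 2 μ := by
  have hi := h.measurableEmbedding i
  have h0 : branchFun σ r c i f = (range (σ i)).indicator (branchFun σ r c i f) := by
    rw [branchFun, indicator_indicator, inter_self]
  have h1 : (branchFun σ r c i f) ∘ σ i =ᵐ[μ] (((r i : ℝ) ^ (-(1 / 2) : ℝ) : ℝ) : ℂ) • f := by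
    filter_upwards [branchFun_comp_self hc i f] with x hx using hx
  have hr : (r i : ℝ≥0∞) ≠ 0 := ENNReal.coe_ne_zero.2 (h.ratio_ne_zero i)
  have h2 : ‖(((r i : ℝ) ^ (-(1 / 2) : ℝ) : ℝ) : ℂ)‖ₑ = (r i : ℝ≥0∞) ^ (-(1 / 2) : ℝ) := by
    rw [← ENNReal.coe_rpow_of_ne_zero (h.ratio_ne_zero i), ← NNReal.coe_rpow, enorm_eq_nnnorm]
    congr 1
    ext
    simp [Real.rpow_nonneg]
  -- Pulling back along `σ i` yields a factor r ^ (1/2) from the measure, which cancels the r ^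
  -- (-1/2) of the function.
  rw [h0, eLpNorm_indicator_eq_eLpNorm_restrict hi.measurableSet_range, h.restrict_range i,
    ENNReal.smul_def, eLpNorm_smul_measure_of_ne_top (by simp), hi.eLpNorm_map_measure,
    eLpNorm_congr_ae h1, eLpNorm_const_smul, h2, smul_eq_mul, ← mul_assoc,
    ← ENNReal.rpow_add _ _ hr ENNReal.coe_ne_top]
  simp

theorem memLp_branchFun (i : ι) {f : X → ℂ} (hf : MemLp f 2 μ) : MemLp (branchFun σ r c i f) 2 μ :=
  ⟨h.aestronglyMeasurable_branchFun hc i hf.1, (h.eLpNorm_branchFun hc i f).trans_lt hf.2⟩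

/-- The isometry `f ↦ χ_{σ i (X)} (r i)^(-1/2) (f ∘ c)` of `L²(X, μ)`. -/
noncomputable def branchIsometry (i : ι) : Lp ℂ 2 μ →ₗᵢ[ℂ] Lp ℂ 2 μ where
  toFun f := (h.memLp_branchFun hc i (Lp.memLp f)).toLp _
  map_add' f g := by
    rw [← MemLp.toLp_add]
    refine MemLp.toLp_congr _ _ ?_
    rw [← branchFun_add]
    exact h.branchFun_ae_congr hc i (Lp.coeFn_add f g)
  map_smul' a f := by
    rw [RingHom.id_apply, ← MemLp.toLp_const_smul]
    refine MemLp.toLp_congr _ _ ?_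
    rw [← branchFun_smul]
    exact h.branchFun_ae_congr hc i (Lp.coeFn_smul a f)
  norm_map' f := by
    change ‖(h.memLp_branchFun hc i (Lp.memLp f)).toLp _‖ = _
    rw [Lp.norm_toLp, h.eLpNorm_branchFun hc i f, Lp.norm_def]

theorem branchIsometry_coeFn (i : ι) (f : Lp ℂ 2 μ) :
    h.branchIsometry hc i f =ᵐ[μ] branchFun σ r c i f :=
  (h.memLp_branchFun hc i (Lp.memLp f)).coeFn_toLp

theorem inner_branchIsometry_of_ne {i j : ι} (hij : i ≠ j) (f g : Lp ℂ 2 μ) :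
    inner ℂ (h.branchIsometry hc i f) (h.branchIsometry hc j g) = 0 := by
  rw [L2.inner_def]
  refine integral_eq_zero_of_ae ?_
  have hd : ∀ᵐ x ∂μ, x ∉ range (σ i) ∩ range (σ j) :=
    measure_eq_zero_iff_ae_notMem.1 (h.overlap i j hij)
  filter_upwards [hd, h.branchIsometry_coeFn hc i f, h.branchIsometry_coeFn hc j g]
    with x hx hf hg
  rw [hf, hg]
  by_cases hxi : x ∈ range (σ i)
  · rw [branchFun, branchFun, indicator_of_notMem fun hxj => hx ⟨hxi, hxj⟩, inner_zero_right]
    rfl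
  · rw [branchFun, indicator_of_notMem hxi, inner_zero_left]
    rfl

/-- The components are r ^ (1/2) (f ∘ σ i), that is, Sᵢ* f. Having the decomposition avoids
computing the adjoints. -/
theorem exists_sum_branchIsometry [Fintype ι] (f : Lp ℂ 2 μ) :
    ∃ g : ι → Lp ℂ 2 μ, ∑ i, h.branchIsometry hc i (g i) = f := by
  have hmem i : MemLp (fun x => (((r i : ℝ) ^ (1 / 2 : ℝ) : ℝ) : ℂ) * f (σ i x)) 2 μ := by
    refine MemLp.const_mul ?_ _
    have h1 : MemLp f 2 (μ.map (σ i)) := by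
      have h2 := (Lp.memLp f).mono_measure (Measure.restrict_le_self (s := range (σ i)))
      have h3 := h2.smul_measure (c := ((r i)⁻¹ : ℝ≥0)) ENNReal.coe_ne_top
      rw [h.restrict_range i] at h3
      have h4 : ((r i)⁻¹ : ℝ≥0) • r i • μ.map (σ i) = μ.map (σ i) := by
        rw [smul_smul, inv_mul_cancel₀ (h.ratio_ne_zero i), one_smul]
      rwa [← ENNReal.smul_def, h4] at h3
    exact h1.comp_of_map (h.measurableEmbedding i).measurable.aemeasurable
  refine ⟨fun i => (hmem i).toLp _, Lp.ext (h.ae_of_forall_ae_comp fun j => ?_)⟩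
  have h1 := (h.quasiMeasurePreserving j).ae
    (Lp.coeFn_finsetSum (f := fun i => h.branchIsometry hc i ((hmem i).toLp _)) Finset.univ)
  have h2 : ∀ᵐ x ∂μ, ∀ i, h.branchIsometry hc i ((hmem i).toLp _) (σ j x) =
      branchFun σ r c i ((hmem i).toLp _) (σ j x) :=
    ae_all_iff.2 fun i => (h.quasiMeasurePreserving j).ae (h.branchIsometry_coeFn hc i _)
  have h3 : ∀ᵐ x ∂μ, ∀ i, i ≠ j → branchFun σ r c i ((hmem i).toLp _) (σ j x) = 0 :=
    ae_all_iff.2 fun i => by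
      by_cases hij : i = j
      · exact .of_forall fun x hx => (hx hij).elim
      · filter_upwards [h.branchFun_comp_of_ne hij ((hmem i).toLp _)] with x hx _ using hx
  filter_upwards [h1, h2, h3, branchFun_comp_self hc j ((hmem j).toLp _),
    (hmem j).coeFn_toLp] with x h1 h2 h3 h4 h5
  have hr : (0 : ℝ) < r j := NNReal.coe_pos.2 (pos_iff_ne_zero.2 (h.ratio_ne_zero j))
  rw [h1, Finset.sum_apply, Finset.sum_eq_single j (fun i _ hij => (h2 i).trans (h3 i hij))
    (fun hj => (hj (Finset.mem_univ j)).elim), h2 j, h4, h5, ← mul_assoc, ← Complex.ofReal_mul,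
    ← Real.rpow_add hr]
  simp

/-- The branch isometries satisfy the Cuntz relations. -/
theorem cuntzRelations_branchIsometry [Fintype ι] :
    CuntzRelations fun i => (h.branchIsometry hc i).toContinuousLinearMap := by
  have h1 i : star (h.branchIsometry hc i).toContinuousLinearMap *
      (h.branchIsometry hc i).toContinuousLinearMap = 1 :=
    (ContinuousLinearMap.norm_map_iff_adjoint_comp_self _).1 (h.branchIsometry hc i).norm_map
  refine ⟨h1, ContinuousLinearMap.ext fun f => ?_⟩
  have h2 i j (hij : i ≠ j) (f : Lp ℂ 2 μ) :
      star (h.branchIsometry hc i).toContinuousLinearMap (h.branchIsometry hc j f) = 0 := by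
    refine ext_inner_left ℂ fun g => ?_
    rw [ContinuousLinearMap.star_eq_adjoint, ContinuousLinearMap.adjoint_inner_right,
      inner_zero_right]
    exact h.inner_branchIsometry_of_ne hc hij g f
  have h3 i (f : Lp ℂ 2 μ) :
      star (h.branchIsometry hc i).toContinuousLinearMap (h.branchIsometry hc i f) = f :=
    DFunLike.congr_fun (h1 i) f
  -- Once f is a sum of vectors Sⱼ gⱼ, the second relation follows from Sᵢ* Sⱼ = δᵢⱼ.
  obtain ⟨g, rfl⟩ := h.exists_sum_branchIsometry hc f
  rw [sum_apply, one_apply_eq_self]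
  refine Finset.sum_congr rfl fun i _ => ?_
  rw [mul_apply_eq_comp, map_sum,
    Finset.sum_eq_single i (fun j _ hji => h2 i j hji.symm _)
      (fun hi => (hi (Finset.mem_univ i)).elim), h3]
  rfl

theorem isBranchOperator_branchIsometry [SigmaFinite μ] {i : ι} {Φ : X → ℝ≥0}
    (hΦ : IsRadonNikodymAlong μ univ (σ i) Φ) :
    IsBranchOperator μ (range (σ i)) Φ c (h.branchIsometry hc i).toContinuousLinearMap := by
  intro f
  filter_upwards [h.branchIsometry_coeFn hc i f,
    (h.quasiMeasurePreserving_codingMap hc).ae (h.radonNikodym_ae_eq hΦ)] with x hx hx'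
  exact hx.trans (by simp only [branchFun, indicator, hx'])

end IsScalingSystem

end ScalingSystem

/-! ### `N`-adic expansions -/

section NAdic

variable {N : ℕ}

/-- The integer with the first `n` digits of `a` in base `N`. -/
def digitPrefix (a : ℕ → Fin N) : ℕ → ℕ
  | 0 => 0
  | n + 1 => N * digitPrefix a n + a n

theorem eq_of_digitPrefix_eq {a b : ℕ → Fin N} {n : ℕ} (h : digitPrefix a n = digitPrefix b n) :
    ∀ k < n, a k = b k := by
  induction n with
  | zero => simp
  | succ n ih =>
    have hN : 0 < N := (a 0).pos
    have h1 := congrArg (· / N) h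
    have h2 := congrArg (· % N) h
    simp only [digitPrefix, Nat.mul_add_div hN, Nat.div_eq_of_lt (a n).isLt,
      Nat.div_eq_of_lt (b n).isLt, Nat.mul_add_mod, Nat.mod_eq_of_lt (a n).isLt,
      Nat.mod_eq_of_lt (b n).isLt, add_zero] at h1 h2
    intro k hk
    rcases Nat.lt_succ_iff_lt_or_eq.1 hk with hk | rfl
    · exact ih h1 k hk
    · exact Fin.ext h2

theorem nAdic_eq_add_shift (a : ℕ → Fin N) :
    nAdic a = (nAdic (fun k => a (k + 1)) + (a 0 : ℝ)) / N := by
  rw [← nAdic_cons]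
  congr 1
  funext k
  cases k <;> rfl

theorem nAdic_eq_digitPrefix (a : ℕ → Fin N) (n : ℕ) :
    nAdic a = (digitPrefix a n + nAdic (fun k => a (k + n))) / (N : ℝ) ^ n := by
  induction n with
  | zero => simp [digitPrefix]
  | succ n ih =>
    have hN : (N : ℝ) ≠ 0 := by exact_mod_cast (a 0).pos.ne'
    rw [ih, nAdic_eq_add_shift fun k => a (k + n)]
    simp only [digitPrefix, zero_add, Nat.cast_add, Nat.cast_mul, add_assoc, add_comm 1 n]
    field_simp
    ring

theorem nAdic_nonneg (a : ℕ → Fin N) : 0 ≤ nAdic a :=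
  tsum_nonneg fun _ => by positivity

theorem nAdic_le_one (hN : 2 ≤ N) (a : ℕ → Fin N) : nAdic a ≤ 1 := by
  have hN0 : (0 : ℝ) < N := by exact_mod_cast (a 0).pos
  have hN1 : (N : ℝ)⁻¹ < 1 := inv_lt_one_of_one_lt₀ (by exact_mod_cast hN)
  -- The expansion with all digits N - 1.
  have h1 : HasSum (fun k => ((N : ℝ) - 1) / N * (N : ℝ)⁻¹ ^ k) 1 := by
    have h2 := (hasSum_geometric_of_lt_one (by positivity) hN1).mul_left (((N : ℝ) - 1) / N)
    have h3 : ((N : ℝ) - 1) / N * (1 - (N : ℝ)⁻¹)⁻¹ = 1 := by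
      have h4 : (N : ℝ) - 1 ≠ 0 := by
        have : (2 : ℝ) ≤ N := by exact_mod_cast hN
        linarith
      field_simp
    rwa [h3] at h2
  refine hasSum_le (fun k => ?_) (nAdic_summable a).hasSum h1
  have h2 : ((a k : ℕ) : ℝ) ≤ N - 1 := by
    rw [le_sub_iff_add_le]
    exact_mod_cast (a k).isLt
  rw [inv_pow, ← div_eq_mul_inv, div_div, ← pow_succ']
  gcongr

theorem continuous_nAdic (hN : 2 ≤ N) : Continuous (nAdic : (ℕ → Fin N) → ℝ) := by
  have hN0 : (0 : ℝ) < N := by positivity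
  have hN1 : (N : ℝ)⁻¹ < 1 := inv_lt_one_of_one_lt₀ (by exact_mod_cast hN)
  refine continuous_tsum (u := fun k => (N : ℝ)⁻¹ ^ k) (fun k => ?_)
    (summable_geometric_of_lt_one (by positivity) hN1) fun k a => ?_
  · exact (continuous_of_discreteTopology (f := fun i : Fin N => (i : ℝ) / (N : ℝ) ^ (k + 1))).comp
      (continuous_apply k)
  · have h2 : ((a k : ℕ) : ℝ) ≤ N := by exact_mod_cast (a k).isLt.le
    rw [Real.norm_of_nonneg (by positivity), inv_pow, pow_succ, div_le_iff₀ (by positivity)]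
    field_simp
    exact h2

/-- N ^ n · `nAdic a` exceeds its prefix by a tail in [0, 1], so the integer prefixes differ by less
than 2. -/
theorem digitPrefix_le_add_one (hN : 2 ≤ N) {a b : ℕ → Fin N} {n : ℕ}
    (h : nAdic a - nAdic b < (N : ℝ)⁻¹ ^ n) : digitPrefix a n ≤ digitPrefix b n + 1 := by
  have hN0 : (0 : ℝ) < N := by positivity
  rw [nAdic_eq_digitPrefix a n, nAdic_eq_digitPrefix b n, inv_pow, ← sub_div, inv_eq_one_div,
    div_lt_div_iff_of_pos_right (by positivity)] at h
  have h1 := nAdic_nonneg fun k => a (k + n)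
  have h2 := nAdic_le_one hN fun k => b (k + n)
  have h3 : (digitPrefix a n : ℝ) < digitPrefix b n + 2 := by linarith
  have h4 : digitPrefix a n < digitPrefix b n + 2 := by exact_mod_cast h3
  omega

end NAdic

/-! ### The fractal as a self-similar set -/

section Fractal

variable {N : ℕ} {A : Matrix (Fin N) (Fin N) ℕ}

/-- The point of the fractal with given digits. -/
noncomputable def codePoint (ω : ℕ → OneEntry A) : sierpinski A :=
  ⟨!₂[nAdic fun k => (ω k).1.1, nAdic fun k => (ω k).1.2], _, _, fun k => (ω k).2, rfl⟩

theorem codePoint_surjective : Function.Surjective (codePoint (A := A)) := by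
  rintro ⟨_, a, b, hab, rfl⟩
  exact ⟨fun k => ⟨(a k, b k), hab k⟩, rfl⟩

theorem continuous_codePoint (hN : 2 ≤ N) : Continuous (codePoint (A := A)) := by
  refine Continuous.subtype_mk ?_ _
  refine (PiLp.continuous_toLp 2 _).comp (continuous_pi fun i => ?_)
  have h1 (k : ℕ) : Continuous fun ω : ℕ → OneEntry A => (ω k).1 :=
    continuous_subtype_val.comp (continuous_apply k)
  fin_cases i
  · exact (continuous_nAdic hN).comp (continuous_pi fun k => continuous_fst.comp (h1 k))
  · exact (continuous_nAdic hN).comp (continuous_pi fun k => continuous_snd.comp (h1 k))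

theorem compactSpace_sierpinski (hN : 2 ≤ N) : CompactSpace (sierpinski A) :=
  codePoint_surjective.compactSpace (continuous_codePoint hN)

theorem codePoint_eq_tau (ω : ℕ → OneEntry A) :
    codePoint ω = tau A (ω 0) (codePoint fun k => ω (k + 1)) := by
  refine Subtype.ext ?_
  simp only [codePoint, tau]
  rw [nAdic_eq_add_shift fun k => (ω k).1.1, nAdic_eq_add_shift fun k => (ω k).1.2]
  simp

theorem iUnion_range_tau : ⋃ p, range (tau A p) = univ := by
  refine eq_univ_of_forall fun z => ?_
  obtain ⟨ω, rfl⟩ := codePoint_surjective z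
  exact mem_iUnion.2 ⟨ω 0, _, (codePoint_eq_tau ω).symm⟩

theorem dist_tau (p : OneEntry A) (z w : sierpinski A) :
    dist (tau A p z) (tau A p w) = (N : ℝ)⁻¹ * dist z w := by
  have hN : (0 : ℝ) < N := by exact_mod_cast p.1.1.pos
  have h1 : (tau A p z).1 - (tau A p w).1 = (N : ℝ)⁻¹ • (z.1 - w.1) := by
    ext i
    fin_cases i <;> simp [tau] <;> field_simp <;> ring
  rw [Subtype.dist_eq, Subtype.dist_eq, dist_eq_norm, dist_eq_norm, h1, norm_smul, norm_inv,
    Real.norm_of_nonneg hN.le]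

theorem lipschitzWith_tau (p : OneEntry A) : LipschitzWith (N : ℝ≥0)⁻¹ (tau A p) :=
  .of_dist_le_mul fun z w => by simpa using (dist_tau p z w).le

theorem antilipschitzWith_tau (p : OneEntry A) : AntilipschitzWith N (tau A p) :=
  .of_le_mul_dist fun z w => by
    have hN : (N : ℝ) ≠ 0 := by exact_mod_cast p.1.1.pos.ne'
    rw [dist_tau, NNReal.coe_natCast, mul_inv_cancel_left₀ hN]

theorem measurableEmbedding_tau (hN : 2 ≤ N) (p : OneEntry A) : MeasurableEmbedding (tau A p) := by
  have := compactSpace_sierpinski (A := A) hN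
  exact ((lipschitzWith_tau p).continuous.isClosedEmbedding
    (antilipschitzWith_tau p).injective).measurableEmbedding

/-- The Lipschitz and antilipschitz constants are reciprocal, so the two resulting bounds coincide.
-/
theorem hausdorffMeasure_tau_image {s : ℝ} (hs : 0 ≤ s) (p : OneEntry A) (E : Set (sierpinski A)) :
    sierpinskiMeasure A s (tau A p '' E) = ((N : ℝ≥0)⁻¹ ^ s : ℝ≥0) * sierpinskiMeasure A s E := by
  have hN : (N : ℝ≥0) ≠ 0 := by exact_mod_cast p.1.1.pos.ne'
  have h1 := (lipschitzWith_tau p).hausdorffMeasure_image_le hs E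
  have h2 := (antilipschitzWith_tau p).le_hausdorffMeasure_image hs E
  rw [← ENNReal.coe_rpow_of_nonneg _ hs] at h1 h2
  refine h1.antisymm ((mul_le_mul_right h2 _).trans_eq ?_)
  rw [← mul_assoc, ← ENNReal.coe_mul, ← NNReal.mul_rpow, inv_mul_cancel₀ hN, NNReal.one_rpow,
    ENNReal.coe_one, one_mul]

/-- The composition of the maps `tau A p` along a finite word. -/
noncomputable def tauWord (A : Matrix (Fin N) (Fin N) ℕ) :
    (n : ℕ) → (Fin n → OneEntry A) → sierpinski A → sierpinski A
  | 0, _ => id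
  | n + 1, w => tau A (w 0) ∘ tauWord A n (Fin.tail w)

theorem iUnion_range_tauWord (n : ℕ) : ⋃ w, range (tauWord A n w) = univ := by
  induction n with
  | zero => exact eq_univ_of_forall fun z => mem_iUnion.2 ⟨Fin.elim0, z, rfl⟩
  | succ n ih =>
    refine eq_univ_of_forall fun z => ?_
    obtain ⟨p, y, rfl⟩ := mem_iUnion.1 (iUnion_range_tau.symm ▸ mem_univ z)
    obtain ⟨w, x, rfl⟩ := mem_iUnion.1 (ih.symm ▸ mem_univ y)
    refine mem_iUnion.2 ⟨Fin.cons p w, x, ?_⟩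
    simp [tauWord]

theorem lipschitzWith_tauWord (n : ℕ) (w : Fin n → OneEntry A) :
    LipschitzWith ((N : ℝ≥0)⁻¹ ^ n) (tauWord A n w) := by
  induction n with
  | zero => simpa [tauWord] using LipschitzWith.id
  | succ n ih =>
    rw [pow_succ']
    exact (lipschitzWith_tau (w 0)).comp (ih _)

end Fractal

/-! ### Finiteness and positivity of the Hausdorff measure -/

section FractalMeasure

open Filter Topology

/-- The similarity dimension `s = log D / log N` satisfies `N^(-s) = D⁻¹`. -/
theorem inv_rpow_log_div_log {N D : ℕ} (hN : 2 ≤ N) (hD : D ≠ 0) :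
    (N : ℝ≥0)⁻¹ ^ (Real.log D / Real.log N) = (D : ℝ≥0)⁻¹ := by
  have hN0 : (0 : ℝ) < N := by positivity
  have hD0 : (0 : ℝ) < D := by positivity
  have hlog : Real.log N ≠ 0 := (Real.log_pos (by exact_mod_cast hN)).ne'
  rw [NNReal.inv_rpow]
  congr 1
  refine NNReal.coe_injective ?_
  rw [NNReal.coe_rpow, NNReal.coe_natCast, NNReal.coe_natCast, Real.rpow_def_of_pos hN0,
    mul_div_cancel₀ _ hlog, Real.exp_log hD0]

variable {N : ℕ} {A : Matrix (Fin N) (Fin N) ℕ}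

theorem hausdorffMeasure_sierpinski_lt_top (hN : 2 ≤ N) {s : ℝ} (hs0 : 0 ≤ s)
    (hs : (N : ℝ≥0)⁻¹ ^ s * Fintype.card (OneEntry A) = 1) :
    sierpinskiMeasure A s univ < ∞ := by
  have := compactSpace_sierpinski (A := A) hN
  have hN1 : (N : ℝ≥0)⁻¹ < 1 := inv_lt_one_of_one_lt₀ (by exact_mod_cast hN)
  set δ := Metric.ediam (univ : Set (sierpinski A))
  have hδ_top : δ ≠ ∞ := (isCompact_univ.isBounded).ediam_ne_top
  have hdiam n (w : Fin n → OneEntry A) :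
      Metric.ediam (range (tauWord A n w)) ≤ ((N : ℝ≥0)⁻¹ ^ n : ℝ≥0) * δ := by
    rw [← image_univ]
    exact (lipschitzWith_tauWord n w).ediam_image_le univ
  have hlim : Tendsto (fun n : ℕ => (((N : ℝ≥0)⁻¹ ^ n : ℝ≥0) : ℝ≥0∞) * δ) atTop (𝓝 0) := by
    have h1 := ENNReal.tendsto_coe.2 (NNReal.tendsto_pow_atTop_nhds_zero_of_lt_one hN1)
    have h2 := ENNReal.Tendsto.mul_const h1 (Or.inr hδ_top)
    rwa [ENNReal.coe_zero, zero_mul] at h2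
  have h1 := Measure.hausdorffMeasure_le_liminf_sum s (univ : Set (sierpinski A)) _ hlim
    (fun n w => range (tauWord A n w)) (.of_forall hdiam)
    (.of_forall fun n => (iUnion_range_tauWord n).ge)
  refine lt_of_le_of_lt (b := δ ^ s) ?_ (ENNReal.rpow_lt_top_of_nonneg hs0 hδ_top)
  -- Every level satisfies the bound δ ^ s, so one level at which `b` is a lower bound suffices.
  refine h1.trans (liminf_le_of_le (by isBoundedDefault) fun b hb => ?_)
  obtain ⟨n, hn⟩ := hb.exists
  refine hn.trans ?_
  calc ∑ w : Fin n → OneEntry A, Metric.ediam (range (tauWord A n w)) ^ s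
      ≤ ∑ _w : Fin n → OneEntry A, (((N : ℝ≥0)⁻¹ ^ n : ℝ≥0) * δ) ^ s :=
        Finset.sum_le_sum fun w _ => ENNReal.rpow_le_rpow (hdiam n w) hs0
    _ = (((N : ℝ≥0)⁻¹ ^ s * Fintype.card (OneEntry A)) ^ n : ℝ≥0) * δ ^ s := by
        have hpow : ((N : ℝ≥0)⁻¹ ^ n) ^ s = ((N : ℝ≥0)⁻¹ ^ s) ^ n := by
          rw [← NNReal.rpow_mul_natCast, mul_comm, NNReal.rpow_natCast_mul]
        rw [Finset.sum_const, Finset.card_univ, Fintype.card_fun, Fintype.card_fin, nsmul_eq_mul,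
          ENNReal.mul_rpow_of_nonneg _ _ hs0, ← ENNReal.coe_rpow_of_nonneg _ hs0, ← mul_assoc,
          mul_pow, hpow, ENNReal.coe_mul, mul_comm (Nat.cast _)]
        simp only [ENNReal.coe_pow, ENNReal.coe_natCast, Nat.cast_pow]
    _ = δ ^ s := by rw [hs, one_pow, ENNReal.coe_one, one_mul]

/-- The uniform Bernoulli measure on digit sequences. -/
noncomputable def bernoulliMeasure (A : Matrix (Fin N) (Fin N) ℕ) [Nonempty (OneEntry A)] :
    Measure (ℕ → OneEntry A) :=
  Measure.infinitePi fun _ => (PMF.uniformOfFintype (OneEntry A)).toMeasure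

variable [Nonempty (OneEntry A)]

instance : IsProbabilityMeasure (bernoulliMeasure A) := by
  unfold bernoulliMeasure
  infer_instance

/-- The two prefixes determine the first n digit pairs, so the set lies in a single cylinder or is
empty. -/
theorem bernoulliMeasure_digitPrefix_le (n i j : ℕ) :
    bernoulliMeasure A {ω | digitPrefix (fun k => (ω k).1.1) n = i ∧
      digitPrefix (fun k => (ω k).1.2) n = j} ≤ (Fintype.card (OneEntry A) : ℝ≥0∞)⁻¹ ^ n := by
  rcases eq_empty_or_nonempty {ω : ℕ → OneEntry A | digitPrefix (fun k => (ω k).1.1) n = i ∧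
      digitPrefix (fun k => (ω k).1.2) n = j} with h | ⟨ω₀, h1, h2⟩
  · rw [h, measure_empty]
    exact zero_le
  · calc _ ≤ bernoulliMeasure A (Set.pi (Finset.range n) fun k => {ω₀ k}) := by
          refine measure_mono fun ω hω k hk => ?_
          have hk := Finset.mem_range.1 hk
          exact Subtype.ext (Prod.ext (eq_of_digitPrefix_eq (hω.1.trans h1.symm) k hk)
            (eq_of_digitPrefix_eq (hω.2.trans h2.symm) k hk))
      _ = _ := by
          rw [bernoulliMeasure, Measure.infinitePi_pi _ fun _ _ => .singleton _]
          simp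

/-- A set of diameter less than `N⁻ⁿ` meets at most nine squares of side `N⁻ⁿ`. -/
theorem bernoulliMeasure_preimage_codePoint_le (hN : 2 ≤ N) {n : ℕ} {U : Set (sierpinski A)}
    (hU : ∀ z ∈ U, ∀ w ∈ U, dist z w < (N : ℝ)⁻¹ ^ n) :
    bernoulliMeasure A (codePoint ⁻¹' U) ≤ 9 * (Fintype.card (OneEntry A) : ℝ≥0∞)⁻¹ ^ n := by
  rcases eq_empty_or_nonempty (codePoint ⁻¹' U) with h | ⟨ω₀, h0⟩
  · rw [h, measure_empty]
    exact zero_le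
  set x₀ := digitPrefix (fun k => (ω₀ k).1.1) n
  set y₀ := digitPrefix (fun k => (ω₀ k).1.2) n
  have hcoord (z w : sierpinski A) (i : Fin 2) : z.1 i - w.1 i ≤ dist z w := by
    rw [Subtype.dist_eq, dist_eq_norm]
    exact (le_abs_self _).trans (PiLp.norm_apply_le (z.1 - w.1) i)
  calc bernoulliMeasure A (codePoint ⁻¹' U)
      ≤ bernoulliMeasure A (⋃ q ∈ Finset.range 3 ×ˢ Finset.range 3,
          {ω | digitPrefix (fun k => (ω k).1.1) n = x₀ + q.1 - 1 ∧
            digitPrefix (fun k => (ω k).1.2) n = y₀ + q.2 - 1}) := by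
        refine measure_mono fun ω hω => ?_
        have h1 := hU _ hω _ h0
        have h2 := hU _ h0 _ hω
        have hx1 := digitPrefix_le_add_one hN ((hcoord _ _ 0).trans_lt h1)
        have hx2 := digitPrefix_le_add_one hN ((hcoord _ _ 0).trans_lt h2)
        have hy1 := digitPrefix_le_add_one hN ((hcoord _ _ 1).trans_lt h1)
        have hy2 := digitPrefix_le_add_one hN ((hcoord _ _ 1).trans_lt h2)
        -- Prefix differences -1, 0, 1 are stored as 0, 1, 2; by `hx2` and `hy2` these subtractions
        -- do not truncate.
        refine mem_iUnion₂.2 ⟨(digitPrefix (fun k => (ω k).1.1) n + 1 - x₀,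
          digitPrefix (fun k => (ω k).1.2) n + 1 - y₀), ?_, ?_⟩
        · simp only [Finset.mem_product, Finset.mem_range]
          omega
        · simp only [mem_ofPred_eq]
          omega
    _ ≤ ∑ q ∈ Finset.range 3 ×ˢ Finset.range 3, bernoulliMeasure A
          {ω | digitPrefix (fun k => (ω k).1.1) n = x₀ + q.1 - 1 ∧
            digitPrefix (fun k => (ω k).1.2) n = y₀ + q.2 - 1} := measure_biUnion_finset_le _ _
    _ ≤ ∑ _q ∈ Finset.range 3 ×ˢ Finset.range 3, (Fintype.card (OneEntry A) : ℝ≥0∞)⁻¹ ^ n :=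
        Finset.sum_le_sum fun q _ => bernoulliMeasure_digitPrefix_le n _ _
    _ = 9 * (Fintype.card (OneEntry A) : ℝ≥0∞)⁻¹ ^ n := by simp

theorem bernoulliMeasure_preimage_codePoint_le_ediam_rpow (hN : 2 ≤ N) {s : ℝ} (hs0 : 0 ≤ s)
    (hs : (N : ℝ≥0)⁻¹ ^ s * Fintype.card (OneEntry A) = 1) {U : Set (sierpinski A)}
    (hU : Metric.ediam U < 1) :
    bernoulliMeasure A (codePoint ⁻¹' U) ≤
      9 * Fintype.card (OneEntry A) * Metric.ediam U ^ s := by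
  have hN0 : (0 : ℝ) < N := by positivity
  have hN1 : (N : ℝ)⁻¹ < 1 := inv_lt_one_of_one_lt₀ (by exact_mod_cast hN)
  have hD : (Fintype.card (OneEntry A) : ℝ≥0∞) ≠ 0 := by simp
  -- The bound is proved for each t slightly above the diameter, then t decreases to it: this covers
  -- diameter zero and gives strict distance bounds.
  have hne : (𝓝[>] Metric.ediam U).NeBot := nhdsGT_neBot_of_exists_gt ⟨1, hU⟩
  have hlim : Tendsto (fun t : ℝ≥0∞ => 9 * (Fintype.card (OneEntry A) : ℝ≥0∞) * t ^ s)
      (𝓝[>] Metric.ediam U) (𝓝 (9 * Fintype.card (OneEntry A) * Metric.ediam U ^ s)) := by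
    refine ENNReal.Tendsto.const_mul ?_ (Or.inr (by finiteness))
    exact (ENNReal.continuous_rpow_const.tendsto _).mono_left nhdsWithin_le_nhds
  refine ge_of_tendsto hlim ?_
  filter_upwards [Ioo_mem_nhdsGT hU] with t ht
  lift t to ℝ≥0 using (ht.2.trans_le le_top).ne
  have ht0 : (0 : ℝ) < t := by
    have := zero_le.trans_lt ht.1
    exact_mod_cast this
  have ht1 : (t : ℝ) ≤ 1 := by exact_mod_cast ht.2.le
  -- With N⁻⁽ⁿ⁺¹⁾ < t ≤ N⁻ⁿ, the mass is at most 9 D⁻ⁿ = 9 D · D⁻⁽ⁿ⁺¹⁾ ≤ 9 D tˢ; the index shift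
  -- costs the factor D.
  obtain ⟨n, hn1, hn2⟩ := exists_nat_pow_near_of_lt_one ht0 ht1 (by positivity) hN1
  have h1 := bernoulliMeasure_preimage_codePoint_le (n := n) hN fun z hz w hw => by
    refine lt_of_lt_of_le ?_ hn2
    have h2 := (Metric.edist_le_ediam_of_mem hz hw).trans_lt ht.1
    rw [edist_nndist] at h2
    exact_mod_cast h2
  refine h1.trans ?_
  have h3 : ((Fintype.card (OneEntry A) : ℝ≥0)⁻¹) = (N : ℝ≥0)⁻¹ ^ s :=
    (eq_inv_of_mul_eq_one_left hs).symm
  have h4 : ((Fintype.card (OneEntry A) : ℝ≥0∞))⁻¹ ^ (n + 1) ≤ (t : ℝ≥0∞) ^ s := by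
    have h5 : ((N : ℝ≥0)⁻¹ ^ s) ^ (n + 1) ≤ t ^ s := by
      rw [← NNReal.rpow_mul_natCast, mul_comm, NNReal.rpow_natCast_mul]
      refine NNReal.rpow_le_rpow ?_ hs0
      rw [← NNReal.coe_le_coe]
      simpa using hn1.le
    rw [← h3] at h5
    rw [← ENNReal.coe_rpow_of_nonneg _ hs0]
    refine le_trans (le_of_eq ?_) (ENNReal.coe_le_coe.2 h5)
    rw [ENNReal.coe_pow, ENNReal.coe_inv (by simp), ENNReal.coe_natCast]
  rw [mul_assoc]
  gcongr
  refine le_trans (le_of_eq ?_) (mul_le_mul_right h4 _)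
  rw [pow_succ', ← mul_assoc, ENNReal.mul_inv_cancel hD (by finiteness), one_mul]

theorem hausdorffMeasure_sierpinski_pos (hN : 2 ≤ N) {s : ℝ} (hs0 : 0 ≤ s)
    (hs : (N : ℝ≥0)⁻¹ ^ s * Fintype.card (OneEntry A) = 1) :
    0 < sierpinskiMeasure A s univ := by
  set C : ℝ≥0∞ := 9 * Fintype.card (OneEntry A) with hC
  have hC0 : C ≠ 0 := by simp [hC]
  have hC1 : C ≠ ∞ := by finiteness
  have hm : Measurable (codePoint (A := A)) := (continuous_codePoint hN).measurable
  have h1 : C⁻¹ • (bernoulliMeasure A).map codePoint ≤ sierpinskiMeasure A s := by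
    refine Measure.le_hausdorffMeasure s _ 2⁻¹ (by simp) fun U hU => ?_
    rw [Measure.smul_apply, smul_eq_mul, ENNReal.inv_mul_le_iff hC0 hC1]
    -- `U` need not be measurable; its closure is, with the same diameter.
    refine (measure_mono subset_closure).trans ?_
    rw [Measure.map_apply hm isClosed_closure.measurableSet, ← Metric.ediam_closure U]
    refine bernoulliMeasure_preimage_codePoint_le_ediam_rpow hN hs0 hs ?_
    rw [Metric.ediam_closure]
    exact hU.trans_lt (by simp)
  refine lt_of_lt_of_le ?_ (h1 univ)
  rw [Measure.smul_apply, Measure.map_apply hm .univ, preimage_univ, measure_univ, smul_eq_mul,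
    mul_one]
  exact ENNReal.inv_pos.2 hC1

end FractalMeasure

/-! ### Almost disjointness of the pieces and the final assembly -/

/-- If the total mass of a finite measurable cover does not exceed the (finite) measure of the
space, then the members of the cover are almost disjoint. -/
theorem measure_inter_eq_zero_of_sum_le {X ι : Type*} [MeasurableSpace X] [Fintype ι]
    {μ : Measure X} [IsFiniteMeasure μ] {R : ι → Set X} (hR : ∀ i, MeasurableSet (R i))
    (hcover : ⋃ i, R i = univ) (hsum : ∑ i, μ (R i) ≤ μ univ) {i j : ι} (hij : i ≠ j) :
    μ (R i ∩ R j) = 0 := by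
  classical
  -- Trimming `R j` by `R i` still leaves a cover, so the total mass cannot drop: the part removed
  -- is null.
  have h1 : ⋃ k, (if k = j then R j \ R i else R k) = univ := by
    refine eq_univ_of_forall fun x => mem_iUnion.2 ?_
    obtain ⟨k, hk⟩ := mem_iUnion.1 (hcover.symm ▸ mem_univ x)
    by_cases hx : x ∈ R i
    · exact ⟨i, by rwa [if_neg hij]⟩
    · refine ⟨k, ?_⟩
      split_ifs with h
      · exact ⟨h ▸ hk, hx⟩
      · exact hk
  have h2 : μ univ ≤ μ (R j \ R i) + ∑ k ∈ Finset.univ.erase j, μ (R k) := by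
    rw [← h1]
    refine (measure_iUnion_fintype_le _ _).trans_eq ?_
    rw [← Finset.add_sum_erase _ _ (Finset.mem_univ j), if_pos rfl]
    congr 1
    exact Finset.sum_congr rfl fun k hk => by rw [if_neg (Finset.ne_of_mem_erase hk)]
  have h3 := hsum.trans h2
  rw [← Finset.add_sum_erase _ _ (Finset.mem_univ j), ← measure_sdiff_add_inter (R j) (hR i),
    add_assoc] at h3
  have h4 := ENNReal.le_of_add_le_add_left (measure_ne_top μ _) h3
  have h5 : ∑ k ∈ Finset.univ.erase j, μ (R k) ≠ ∞ :=
    ENNReal.sum_ne_top.2 fun k _ => measure_ne_top μ _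
  have h6 : μ (R j ∩ R i) + ∑ k ∈ Finset.univ.erase j, μ (R k) ≤
      0 + ∑ k ∈ Finset.univ.erase j, μ (R k) := by rwa [zero_add]
  rw [inter_comm]
  exact le_zero_iff.1 (ENNReal.le_of_add_le_add_right h5 h6)

theorem isScalingSystem_tau {N : ℕ} {A : Matrix (Fin N) (Fin N) ℕ} (hN : 2 ≤ N) {s : ℝ}
    (hs0 : 0 ≤ s) (hs : (N : ℝ≥0)⁻¹ ^ s * Fintype.card (OneEntry A) = 1) :
    IsScalingSystem (sierpinskiMeasure A s) (tau A) (fun _ => (N : ℝ≥0)⁻¹ ^ s) where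
  measurableEmbedding := measurableEmbedding_tau hN
  ratio_ne_zero _ := left_ne_zero_of_mul_eq_one hs
  measure_image p E _ := hausdorffMeasure_tau_image hs0 p E
  cover := by rw [iUnion_range_tau, compl_univ, measure_empty]
  overlap p q hpq := by
    have : IsFiniteMeasure (sierpinskiMeasure A s) := ⟨hausdorffMeasure_sierpinski_lt_top hN hs0 hs⟩
    refine measure_inter_eq_zero_of_sum_le
      (fun p => (measurableEmbedding_tau hN p).measurableSet_range) iUnion_range_tau ?_ hpq
    have h1 : ((((N : ℝ≥0)⁻¹ ^ s : ℝ≥0) : ℝ≥0∞)) * Fintype.card (OneEntry A) = 1 := by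
      exact_mod_cast congrArg ((↑) : ℝ≥0 → ℝ≥0∞) hs
    simp_rw [← image_univ, hausdorffMeasure_tau_image hs0]
    rw [Finset.sum_const, Finset.card_univ, nsmul_eq_mul, ← mul_assoc, mul_comm (Nat.cast _), h1,
      one_mul]

/-- Needed because a `CuntzFamily` must live in a nonzero algebra; the constant 1 is a nonzero
vector. -/
theorem nontrivial_Lp_two {X : Type*} [MeasurableSpace X] {μ : Measure X} [IsFiniteMeasure μ]
    (h : μ univ ≠ 0) : Nontrivial (Lp ℂ 2 μ) := by
  refine ⟨(memLp_const (1 : ℂ)).toLp _, 0, fun h0 => h ?_⟩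
  have h1 := (Lp.eq_zero_iff_ae_eq_zero.1 h0).symm.trans (memLp_const (1 : ℂ)).coeFn_toLp
  have h2 : ∀ᵐ x ∂μ, x ∉ univ := h1.mono fun x hx => (zero_ne_one hx).elim
  exact measure_eq_zero_iff_ae_notMem.2 h2

theorem dimH_eq_of_hausdorffMeasure_subtype {X : Type*} [EMetricSpace X] [MeasurableSpace X]
    [BorelSpace X] {K : Set X} {s : ℝ} (hs : 0 ≤ s)
    (h0 : Measure.hausdorffMeasure s (univ : Set K) ≠ 0)
    (h1 : Measure.hausdorffMeasure s (univ : Set K) ≠ ∞) : dimH K = ENNReal.ofReal s := by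
  lift s to ℝ≥0 using hs
  have hK : Isometry ((↑) : K → X) := fun _ _ => rfl
  have h2 : Measure.hausdorffMeasure (s : ℝ) K =
      Measure.hausdorffMeasure (s : ℝ) (univ : Set K) := by
    rw [← hK.hausdorffMeasure_image (Or.inl s.coe_nonneg), image_univ,
      Subtype.range_coe]
  rw [ENNReal.ofReal_coe_nnreal]
  exact dimH_of_hausdorffMeasure_ne_zero_ne_top (h2 ▸ h0) (h2 ▸ h1)

theorem lemma2p22 (N : ℕ) (hN : 2 ≤ N) (A : Matrix (Fin N) (Fin N) ℕ)
    (hA : ∀ i j, A i j = 0 ∨ A i j = 1) (hA0 : A ≠ 0)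
    (s : ℝ) (hs : s = Real.log (numOnes A) / Real.log N)
    (μ : Measure (sierpinski A)) (hμ : μ = sierpinskiMeasure A s) :
    dimH (sierpinski A) = ENNReal.ofReal s ∧
    0 < μ Set.univ ∧ μ Set.univ < ∞ ∧
    IsSemibranchingSystem μ (fun _ : OneEntry A => Set.univ) (tau A) ∧
    (∃ c, IsCodingMap μ (fun _ : OneEntry A => Set.univ) (tau A) c) ∧
    ∀ (c : sierpinski A → sierpinski A) (Φ : OneEntry A → sierpinski A → ℝ≥0),
      IsCodingMap μ (fun _ : OneEntry A => Set.univ) (tau A) c →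
      (∀ p, IsRadonNikodymAlong μ Set.univ (tau A p) (Φ p)) →
      ∃ S : OneEntry A → (Lp ℂ 2 μ →L[ℂ] Lp ℂ 2 μ),
        (∀ p, IsBranchOperator μ (Set.range (tau A p)) (Φ p) c (S p)) ∧
        CuntzRelations S ∧
        ∃! π : cuntzAlgebra (OneEntry A) →⋆ₐ[ℂ] (Lp ℂ 2 μ →L[ℂ] Lp ℂ 2 μ),
          ∀ p, π (cuntzGen (OneEntry A) p) = S p := by
  obtain ⟨p⟩ : Nonempty (OneEntry A) := by
    by_contra hempty
    refine hA0 (Matrix.ext fun i j => (hA i j).resolve_right fun hij => hempty ⟨⟨(i, j), hij⟩⟩)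
  have hne : Nonempty (OneEntry A) := ⟨p⟩
  have hs0 : 0 ≤ s := hs ▸ div_nonneg (Real.log_natCast_nonneg _) (Real.log_natCast_nonneg _)
  have hD : numOnes A ≠ 0 := card_oneEntry A ▸ Fintype.card_ne_zero
  have hs1 : (N : ℝ≥0)⁻¹ ^ s * Fintype.card (OneEntry A) = 1 := by
    rw [hs, inv_rpow_log_div_log hN hD, card_oneEntry]
    exact inv_mul_cancel₀ (Nat.cast_ne_zero.2 hD)
  have hpos := hausdorffMeasure_sierpinski_pos hN hs0 hs1
  have hlt := hausdorffMeasure_sierpinski_lt_top hN hs0 hs1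
  have hsys := isScalingSystem_tau hN hs0 hs1
  have hdim : dimH (sierpinski A) = ENNReal.ofReal s :=
    dimH_eq_of_hausdorffMeasure_subtype hs0 hpos.ne' hlt.ne
  rw [← hμ] at hpos hlt hsys
  have hfin : IsFiniteMeasure μ := ⟨hlt⟩
  have hnt : Nontrivial (Lp ℂ 2 μ) := nontrivial_Lp_two hpos.ne'
  refine ⟨hdim, hpos, hlt, hsys.isSemibranchingSystem, hsys.exists_isCodingMap, ?_⟩
  intro c Φ hc hΦ
  exact ⟨fun p => (hsys.branchIsometry hc p).toContinuousLinearMap,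
    fun p => hsys.isBranchOperator_branchIsometry hc (hΦ p),
    hsys.cuntzRelations_branchIsometry hc,
    existsUnique_cuntzAlgebra_hom (hsys.cuntzRelations_branchIsometry hc)⟩
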